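/- Let $\Omega$ be a non-empty set, $\mathcal A$ an algebra of subsets of $\Omega$ and $\sigma\mathcal A$ the $\sigma$-algebra it generates. For an algebra $\mathcal S$ of subsets of $\Omega$ let $ba(\mathcal S)$ be the space of real-valued, finitely additive set functions $\mu$ on $\mathcal S$ with finite total variation norm $\|\mu\|=|\mu|(\Omega)$, where $|\mu|(A)=\sup_\pi\sum_{E\in\pi}|\mu(A\cap E)|$ for $A\in\mathcal S$, the supremum being over all partitions $\pi$ of $\Omega$ into finitely many members of $\mathcal S$. It is ordered setwise, $ba(\mathcal S)_+$ is its positive cone, and $\mu\wedge\nu$ is the lattice meet. Let $\mathrm{Prob}(\mathcal S)=\{\lambda\in ba(\mathcal S)_+:\lambda(\Omega)=1\}$. Countable additivity is not assumed. A sequence $F_1,F_2,\ldots$ in $ba(\sigma\mathcal A)$ is called independent relatively to $\lambda\in ba(\sigma\mathcal A)$ if every $F_n$ is absolutely continuous with respect to $\lambda$ (for each $\varepsilon>0$ there is $\eta>0$ such that $|\lambda|(A)<\eta$ implies $|F_n|(A)<\varepsilon$, for all $A\in\sigma\mathcal A$) and there are algebras $\mathcal A_1,\mathcal A_2,\ldots\subseteq\mathcal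 A$ of subsets of $\Omega$ such that (i) $\inf_h\|F_n-\lambda_h\|=0$ for each $n$, where $h$ ranges over the simple $\mathcal A_n$-measurable functions $\Omega\to\mathbb R$ and $\lambda_h(A)=\int_A h\,d\lambda$ for $A\in\sigma\mathcal A$; (ii) for each partition $\{N_1,N_2,\ldots\}$ of $\mathbb N$ into non-empty finite sets, and all $B_i$ in the algebra $\bigvee_{n\in N_i}\mathcal A_n$ generated by $\bigcup_{n\in N_i}\mathcal A_n$ ($i=1,2,\ldots$), $\lambda\big(\bigcap_iB_i\big)=\prod_{i=1}^\infty\lambda(B_i)$. **Corollary.** Let $F_1,F_2,\ldots$ be a norm bounded sequence in $ba(\sigma\mathcal A)_+$ which is independent relatively to $\lambda\in\mathrm{Prob}(\sigma\mathcal A)$, and let $\delta>0$. Then there exist $\xi\in ba(\sigma\mathcal A)_+$ with $$\|\xi\|\ \ge\ \sup_k\limsup_n\big\|F_n\wedge2^k\lambda\big\|-\delta$$ and a sequence $G_1,G_2,\ldots$ in $ba(\sigma\mathcal A)$ with $G_n\in\mathrm{co}(F_n,F_{n+1},\ldots)$ for each $n$ such that, for each $\varepsilon>0$, there is $A_\varepsilon\in\sigma\mathcal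 A$ satisfying $$\xi(A_\varepsilon^c)<\varepsilon\qquad\text{and}\qquad\lim_n|G_n-\xi|(A_\varepsilon)=0 .$$ -/

import Mathlib

open Filter Topology MeasureTheory

namespace FinAdd

noncomputable section

/-- `Π(𝓐)`: the partitions of `Ω` into finitely many elements of `𝓐`. -/
def finPartitions {Ω : Type*} (𝓐 : Set (Set Ω)) : Set (Finset (Set Ω)) :=
  {π | (∀ E ∈ π, E ∈ 𝓐) ∧ (π : Set (Set Ω)).PairwiseDisjoint id ∧
    ⋃₀ (π : Set (Set Ω)) = Set.univ}

/-- The space `ba(𝓐)` of real-valued additive set functions on `𝓐` of bounded total variation.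
An element is a function on all subsets of `Ω` that is set to `0` outside `𝓐`, so that it is
determined by its values on `𝓐`, and the pointwise order is the setwise order on `𝓐`. -/
def ba {Ω : Type*} (𝓐 : Set (Set Ω)) : Submodule ℝ (Set Ω → ℝ) where
  carrier := {μ | (∀ A, A ∉ 𝓐 → μ A = 0) ∧
    (∀ A ∈ 𝓐, ∀ B ∈ 𝓐, Disjoint A B → μ (A ∪ B) = μ A + μ B) ∧
    ∃ C : ℝ, ∀ π ∈ finPartitions 𝓐, ∑ E ∈ π, |μ E| ≤ C}
  zero_mem' := ⟨fun _ _ => rfl, fun _ _ _ _ _ => by simp, 0, fun _ _ => by simp⟩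
  add_mem' := by
    rintro μ ν ⟨hμ₀, hμ, C, hC⟩ ⟨hν₀, hν, D, hD⟩
    refine ⟨fun A hA => by simp [hμ₀ A hA, hν₀ A hA], fun A hA B hB hAB => ?_, C + D,
      fun π hπ => ?_⟩
    · simp only [Pi.add_apply, hμ A hA B hB hAB, hν A hA B hB hAB]
      ring
    · calc ∑ E ∈ π, |(μ + ν) E| ≤ ∑ E ∈ π, (|μ E| + |ν E|) :=
            Finset.sum_le_sum fun E _ => abs_add_le _ _
        _ = ∑ E ∈ π, |μ E| + ∑ E ∈ π, |ν E| := Finset.sum_add_distrib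
        _ ≤ C + D := add_le_add (hC π hπ) (hD π hπ)
  smul_mem' := by
    rintro c μ ⟨hμ₀, hμ, C, hC⟩
    refine ⟨fun A hA => by simp [hμ₀ A hA], fun A hA B hB hAB => ?_, |c| * C, fun π hπ => ?_⟩
    · simp only [Pi.smul_apply, smul_eq_mul, hμ A hA B hB hAB]
      ring
    · simp only [Pi.smul_apply, smul_eq_mul, abs_mul, ← Finset.mul_sum]
      exact mul_le_mul_of_nonneg_left (hC π hπ) (abs_nonneg c)

/-- The total variation `|μ|(A) = sup_{π ∈ Π(𝓐)} ∑_{E ∈ π} |μ(A ∩ E)|`, for `A ∈ 𝓐`. -/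
def variation {Ω : Type*} (𝓐 : Set (Set Ω)) (μ : Set Ω → ℝ) (A : Set Ω) : ℝ :=
  sSup ((fun π : Finset (Set Ω) => ∑ E ∈ π, |μ (A ∩ E)|) '' finPartitions 𝓐)

/-- The total variation norm `‖μ‖ = |μ|(Ω)`. -/
def tvNorm {Ω : Type*} (𝓐 : Set (Set Ω)) (μ : Set Ω → ℝ) : ℝ :=
  variation 𝓐 μ Set.univ

open Classical in
/-- The lattice meet `μ ∧ ν` in `ba(𝓐)`,
`(μ ∧ ν)(A) = inf {μ(B) + ν(A \ B) : B ∈ 𝓐, B ⊆ A}` for `A ∈ 𝓐`. That it belongs to `ba(𝓐)` and is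
the greatest lower bound there is proved below (`meet_mem_ba`, `isGLB_meet`). -/
def meet {Ω : Type*} (𝓐 : Set (Set Ω)) (μ ν : Set Ω → ℝ) (A : Set Ω) : ℝ :=
  if A ∈ 𝓐 then sInf ((fun B => μ B + ν (A \ B)) '' {B | B ∈ 𝓐 ∧ B ⊆ A}) else 0

/-- `Prob(𝓐)`: the finitely additive probabilities on `𝓐`. -/
def Prob {Ω : Type*} (𝓐 : Set (Set Ω)) : Set (ba 𝓐) :=
  {μ | 0 ≤ μ ∧ (μ : Set Ω → ℝ) Set.univ = 1}

/-- `lam ≫ μ` on `𝓐`: absolute continuity of set functions in `ba(𝓐)`. -/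
def AbsCont {Ω : Type*} (𝓐 : Set (Set Ω)) (lam μ : Set Ω → ℝ) : Prop :=
  ∀ ε : ℝ, 0 < ε → ∃ δ : ℝ, 0 < δ ∧
    ∀ A ∈ 𝓐, variation 𝓐 lam A < δ → variation 𝓐 μ A < ε

/-- `Sim(𝓑)`: the simple `𝓑`-measurable functions. -/
def Sim {Ω : Type*} (𝓑 : Set (Set Ω)) : Set (Ω → ℝ) :=
  {h | (Set.range h).Finite ∧ ∀ c : ℝ, h ⁻¹' {c} ∈ 𝓑}

open Classical in
/-- The set function `lam_h(A) = ∫_A h d lam`, `A ∈ 𝓐`, for a simple function `h`: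
`∑_c c * lam(A ∩ {h = c})`, the sum being over the finitely many values `c` of `h`. -/
def density {Ω : Type*} (𝓐 : Set (Set Ω)) (lam : Set Ω → ℝ) (h : Ω → ℝ) (A : Set Ω) : ℝ :=
  if A ∈ 𝓐 then ∑ᶠ c ∈ Set.range h, c * lam (A ∩ h ⁻¹' {c}) else 0

/-- `σ𝓐`: the members of the `σ`-algebra generated by `𝓐`. -/
def sigmaAlg {Ω : Type*} (𝓐 : Set (Set Ω)) : Set (Set Ω) :=
  {A | MeasurableSet[MeasurableSpace.generateFrom 𝓐] A}

/-- The sequence `F` in `ba(σ𝓐)` is independent relatively to `lam ∈ ba(σ𝓐)`. The algebra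
`⋁_{n ∈ N i} 𝓐ₙ` is the one generated by `⋃_{n ∈ N i} 𝓐ₙ`. -/
def IndependentRel {Ω : Type*} (𝓐 : Set (Set Ω)) (F : ℕ → ba (sigmaAlg 𝓐))
    (lam : ba (sigmaAlg 𝓐)) : Prop :=
  (∀ n, AbsCont (sigmaAlg 𝓐) lam (F n)) ∧
  ∃ 𝓑 : ℕ → Set (Set Ω),
    (∀ n, IsSetAlgebra (𝓑 n) ∧ 𝓑 n ⊆ 𝓐) ∧
    (∀ n, ⨅ h : Sim (𝓑 n),
      tvNorm (sigmaAlg 𝓐) ((F n : Set Ω → ℝ) - density (sigmaAlg 𝓐) lam h) = 0) ∧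
    ∀ N : ℕ → Finset ℕ, (∀ i, (N i).Nonempty) → Pairwise (fun i j => Disjoint (N i) (N j)) →
      (∀ n, ∃ i, n ∈ N i) →
      ∀ B : ℕ → Set Ω, (∀ i, B i ∈ generateSetAlgebra (⋃ n ∈ N i, 𝓑 n)) →
        HasProd (fun i => (lam : Set Ω → ℝ) (B i)) ((lam : Set Ω → ℝ) (⋂ i, B i))

theorem abs_le_of_mem_ba {Ω : Type*} {𝓐 : Set (Set Ω)} (h𝓐 : IsSetAlgebra 𝓐)
    {μ : Set Ω → ℝ} (hμ : μ ∈ ba 𝓐) : ∃ C : ℝ, ∀ A ∈ 𝓐, |μ A| ≤ C := by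
  classical
  obtain ⟨_, _, C, hC⟩ := hμ
  refine ⟨C, fun A hA => ?_⟩
  have := hC {A, Aᶜ} ⟨by simp [hA, h𝓐.compl_mem hA], ?_, by simp⟩
  · exact (Finset.single_le_sum (f := fun E => |μ E|) (fun _ _ => abs_nonneg _)
      (by simp)).trans this
  · intro x hx y hy hxy
    simp only [Finset.coe_insert, Finset.coe_singleton, Set.mem_insert_iff,
      Set.mem_singleton_iff] at hx hy
    rcases hx with rfl | rfl <;> rcases hy with rfl | rfl
    · exact absurd rfl hxy
    · exact disjoint_compl_right
    · exact disjoint_compl_left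
    · exact absurd rfl hxy

theorem sum_eq_biUnion {Ω : Type*} {𝓐 : Set (Set Ω)} (h𝓐 : IsSetAlgebra 𝓐) {μ : Set Ω → ℝ}
    (hadd : ∀ A ∈ 𝓐, ∀ B ∈ 𝓐, Disjoint A B → μ (A ∪ B) = μ A + μ B)
    (s : Finset (Set Ω)) (hs : ∀ E ∈ s, E ∈ 𝓐) (hd : (s : Set (Set Ω)).PairwiseDisjoint id) :
    (⋃ E ∈ s, E) ∈ 𝓐 ∧ ∑ E ∈ s, μ E = μ (⋃ E ∈ s, E) := by
  classical
  have h0 : μ ∅ = 0 := by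
    have := hadd ∅ h𝓐.empty_mem ∅ h𝓐.empty_mem (by simp)
    simpa using this
  induction s using Finset.induction_on with
  | empty => simp [h0, h𝓐.empty_mem]
  | insert a s ha ih =>
    have ih' := ih (fun E hE => hs E (Finset.mem_insert_of_mem hE))
      (hd.subset (by simp))
    have haA := hs a (Finset.mem_insert_self _ _)
    have hdis : Disjoint a (⋃ E ∈ s, E) := by
      simp only [Set.disjoint_iUnion_right]
      intro E hE
      exact hd (by simp) (by simp [hE]) (fun h => ha (h ▸ hE))
    rw [Finset.set_biUnion_insert]
    refine ⟨h𝓐.union_mem haA ih'.1, ?_⟩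
    rw [Finset.sum_insert ha, ih'.2, hadd _ haA _ ih'.1 hdis]

theorem mem_ba_of_bounded {Ω : Type*} {𝓐 : Set (Set Ω)} (h𝓐 : IsSetAlgebra 𝓐) {μ : Set Ω → ℝ}
    (h0 : ∀ A, A ∉ 𝓐 → μ A = 0)
    (hadd : ∀ A ∈ 𝓐, ∀ B ∈ 𝓐, Disjoint A B → μ (A ∪ B) = μ A + μ B)
    {C : ℝ} (hC : ∀ A ∈ 𝓐, |μ A| ≤ C) : μ ∈ ba 𝓐 := by
  classical
  refine ⟨h0, hadd, C + C, fun π hπ => ?_⟩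
  have key : ∀ (p : Set Ω → Prop) [DecidablePred p], |∑ E ∈ π.filter p, μ E| ≤ C := fun p _ => by
    have := sum_eq_biUnion h𝓐 hadd (π.filter p)
      (fun E hE => hπ.1 E (Finset.mem_filter.1 hE).1)
      (hπ.2.1.subset (by exact_mod_cast Finset.filter_subset p π))
    rw [this.2]
    exact hC _ this.1
  rw [← Finset.sum_filter_add_sum_filter_not π (fun E => 0 ≤ μ E)]
  refine add_le_add ?_ ?_
  · rw [Finset.sum_congr rfl (g := μ) (fun E hE => abs_of_nonneg (Finset.mem_filter.1 hE).2)]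
    exact (le_abs_self _).trans (key _)
  · rw [Finset.sum_congr rfl (g := fun E => -μ E)
      (fun E hE => abs_of_neg (not_le.1 (Finset.mem_filter.1 hE).2)), Finset.sum_neg_distrib]
    exact (neg_le_abs _).trans (key _)

theorem bddBelow_meet {Ω : Type*} {𝓐 : Set (Set Ω)} (h𝓐 : IsSetAlgebra 𝓐) {μ ν : Set Ω → ℝ}
    {C D : ℝ} (hC : ∀ A ∈ 𝓐, |μ A| ≤ C) (hD : ∀ A ∈ 𝓐, |ν A| ≤ D) {A : Set Ω} (hA : A ∈ 𝓐) :
    ∀ x ∈ (fun B => μ B + ν (A \ B)) '' {B | B ∈ 𝓐 ∧ B ⊆ A}, -(C + D) ≤ x := by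
  rintro _ ⟨B, ⟨hB, _⟩, rfl⟩
  have h1 := (abs_le.1 (hC B hB)).1
  have h2 := (abs_le.1 (hD _ (h𝓐.sdiff_mem hA hB))).1
  dsimp only
  linarith

theorem meet_mem_ba {Ω : Type*} {𝓐 : Set (Set Ω)} (h𝓐 : IsSetAlgebra 𝓐) {μ ν : Set Ω → ℝ}
    (hμ : μ ∈ ba 𝓐) (hν : ν ∈ ba 𝓐) : meet 𝓐 μ ν ∈ ba 𝓐 := by
  obtain ⟨C, hC⟩ := abs_le_of_mem_ba h𝓐 hμ
  obtain ⟨D, hD⟩ := abs_le_of_mem_ba h𝓐 hν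
  have hbd := fun {A : Set Ω} (hA : A ∈ 𝓐) => bddBelow_meet h𝓐 hC hD hA
  have hne : ∀ A : Set Ω, ((fun B => μ B + ν (A \ B)) '' {B | B ∈ 𝓐 ∧ B ⊆ A}).Nonempty :=
    fun A => ⟨_, ∅, ⟨h𝓐.empty_mem, by simp⟩, rfl⟩
  have h0 : μ ∅ = 0 := by
    have := hμ.2.1 ∅ h𝓐.empty_mem ∅ h𝓐.empty_mem (by simp)
    simpa using this
  refine mem_ba_of_bounded h𝓐 (C := C + D) (fun A hA => by simp [meet, hA])
    (fun A hA A' hA' hd => ?_) (fun A hA => ?_)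
  · have hU := h𝓐.union_mem hA hA'
    simp only [meet, hA, hA', hU, if_true]
    apply le_antisymm
    · rw [← sub_le_iff_le_add]
      refine le_csInf (hne A) ?_
      rintro _ ⟨B, ⟨hB, hBA⟩, rfl⟩
      rw [sub_le_comm]
      refine le_csInf (hne A') ?_
      rintro _ ⟨B', ⟨hB', hBA'⟩, rfl⟩
      rw [sub_le_iff_le_add]
      refine (csInf_le ⟨_, hbd hU⟩ ⟨B ∪ B', ⟨h𝓐.union_mem hB hB',
        Set.union_subset_union hBA hBA'⟩, rfl⟩).trans (le_of_eq ?_)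
      have e : (A ∪ A') \ (B ∪ B') = (A \ B) ∪ (A' \ B') := by
        ext x
        have h1 := @hBA x
        have h2 := @hBA' x
        have h3 : x ∈ A → x ∉ A' := fun h => Set.disjoint_left.1 hd h
        simp only [Set.mem_sdiff, Set.mem_union]
        tauto
      dsimp only
      rw [e, hμ.2.1 B hB B' hB' (hd.mono hBA hBA'),
        hν.2.1 _ (h𝓐.sdiff_mem hA hB) _ (h𝓐.sdiff_mem hA' hB')
          (hd.mono Set.sdiff_subset Set.sdiff_subset)]
      ring
    · refine le_csInf (hne _) ?_
      rintro _ ⟨B, ⟨hB, hBA⟩, rfl⟩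
      have i1 := csInf_le ⟨_, hbd hA⟩ (Set.mem_image_of_mem (fun B => μ B + ν (A \ B))
        (⟨h𝓐.inter_mem hB hA, Set.inter_subset_right⟩ : B ∩ A ∈ {B | B ∈ 𝓐 ∧ B ⊆ A}))
      have i2 := csInf_le ⟨_, hbd hA'⟩ (Set.mem_image_of_mem (fun B => μ B + ν (A' \ B))
        (⟨h𝓐.inter_mem hB hA', Set.inter_subset_right⟩ : B ∩ A' ∈ {B | B ∈ 𝓐 ∧ B ⊆ A'}))
      refine (add_le_add i1 i2).trans (le_of_eq ?_)
      have e1 : B = (B ∩ A) ∪ (B ∩ A') := by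
        rw [← Set.inter_union_distrib_left, Set.inter_eq_left.2 hBA]
      have e2 : (A ∪ A') \ B = (A \ (B ∩ A)) ∪ (A' \ (B ∩ A')) := by
        ext x
        simp only [Set.mem_sdiff, Set.mem_union, Set.mem_inter_iff]
        tauto
      have m1 := hμ.2.1 _ (h𝓐.inter_mem hB hA) _ (h𝓐.inter_mem hB hA')
        (hd.mono Set.inter_subset_right Set.inter_subset_right)
      have m2 := hν.2.1 _ (h𝓐.sdiff_mem hA (h𝓐.inter_mem hB hA)) _
        (h𝓐.sdiff_mem hA' (h𝓐.inter_mem hB hA')) (hd.mono Set.sdiff_subset Set.sdiff_subset)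
      rw [← e1] at m1
      rw [← e2] at m2
      dsimp only
      rw [m1, m2]
      ring
  · simp only [meet, hA, if_true]
    rw [abs_le]
    refine ⟨le_csInf (hne A) (hbd hA), ?_⟩
    refine (csInf_le ⟨_, hbd hA⟩ ⟨∅, ⟨h𝓐.empty_mem, by simp⟩, rfl⟩).trans ?_
    have h1 := (abs_le.1 (hD A hA)).2
    have h2 := (abs_nonneg _).trans (hC A hA)
    simp only [h0, Set.sdiff_empty]
    linarith

theorem isGLB_meet {Ω : Type*} {𝓐 : Set (Set Ω)} (h𝓐 : IsSetAlgebra 𝓐) (μ ν : ba 𝓐) :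
    IsGLB {μ, ν} (⟨meet 𝓐 μ ν, meet_mem_ba h𝓐 μ.2 ν.2⟩ : ba 𝓐) := by
  obtain ⟨C, hC⟩ := abs_le_of_mem_ba h𝓐 μ.2
  obtain ⟨D, hD⟩ := abs_le_of_mem_ba h𝓐 ν.2
  have hbd := fun {A : Set Ω} (hA : A ∈ 𝓐) => bddBelow_meet h𝓐 hC hD hA
  have z : ∀ κ : ba 𝓐, κ.1 ∅ = 0 := fun κ => by
    have := κ.2.2.1 ∅ h𝓐.empty_mem ∅ h𝓐.empty_mem (by simp)
    simpa using this
  constructor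
  · rintro κ (rfl | rfl) A
    · by_cases hA : A ∈ 𝓐
      · simp only [meet, hA, if_true]
        refine (csInf_le ⟨_, hbd hA⟩ ⟨A, ⟨hA, subset_rfl⟩, rfl⟩).trans (le_of_eq ?_)
        simp [z]
      · simp [meet, hA, κ.2.1 A hA]
    · by_cases hA : A ∈ 𝓐
      · simp only [meet, hA, if_true]
        refine (csInf_le ⟨_, hbd hA⟩ ⟨∅, ⟨h𝓐.empty_mem, by simp⟩, rfl⟩).trans (le_of_eq ?_)
        simp [z]
      · simp [meet, hA, κ.2.1 A hA]
  · intro κ hκ A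
    have k1 : κ ≤ μ := hκ (by simp)
    have k2 : κ ≤ ν := hκ (by simp)
    by_cases hA : A ∈ 𝓐
    · simp only [meet, hA, if_true]
      refine le_csInf ⟨_, ∅, ⟨h𝓐.empty_mem, by simp⟩, rfl⟩ ?_
      rintro _ ⟨B, ⟨hB, hBA⟩, rfl⟩
      have := κ.2.2.1 B hB (A \ B) (h𝓐.sdiff_mem hA hB) disjoint_sdiff_self_right
      rw [Set.union_sdiff_cancel hBA] at this
      have e : (κ : Set Ω → ℝ) A = κ.1 A := rfl
      rw [e, this]
      exact add_le_add (k1 B) (k2 _)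
    · simp [meet, hA, κ.2.1 A hA]

end

end FinAdd

/-! Each `F n` is, up to `1/(n+1)` in norm, the density of a simple function, and these functions
are independent under `lam`. Their positive parts `f n` have bounded integrals, but mass may escape
to ever larger values. Truncated means `∫ min (f n) (2^k)` converge along a subsequence `φ`, for
every `k`, to some `d k`. With `D = sup d k`, the limit is `ξ = D • lam`, and `G n` is the average
of `F (φ i)` over `n ≤ i ≤ 2n`.

On `A N = ⋂_{i ≥ N} {f (φ i) ≤ 2^i}` the function `f (φ i)` equals its truncation at `2^i` for `i ≥
N`. The part between levels `2^k` and `2^i` has mean close to `d i - d k ≤ D - d k`, which is small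
for large `k`. The part truncated at the fixed level `2^k` obeys a weak law of large numbers, proved
through variances. So the averages converge in mean, uniformly over measurable subsets of `A N`.

Markov's inequality gives `lam {f (φ i) > 2^i} ≤ C/2^i`. Countable subadditivity not being
available, `A N` is estimated by the infinite product that independence provides. The norm bound
holds because `‖F n ∧ 2^k lam‖` is, up to a vanishing error, at most `∫ min (f n) (2^k)`. -/

namespace FinAdd

/-! ### Integration of simple functions against a finitely additive probability; a weak law. -/

section FiniteAdditiveIntegral

variable {Ω : Type*} [MeasurableSpace Ω] {l : Set Ω → ℝ}

/-- Finitely additive probabilities on the measurable sets. -/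
structure IsFinAddProb (l : Set Ω → ℝ) : Prop where
  nonneg : ∀ A, MeasurableSet A → 0 ≤ l A
  union : ∀ A, MeasurableSet A → ∀ B, MeasurableSet B → Disjoint A B → l (A ∪ B) = l A + l B
  univ : l Set.univ = 1

namespace IsFinAddProb

/-- The reference measure `0` makes every finiteness condition vacuous, so the calculus of
`setToSimpleFunc` applies to all simple functions although `l` is not a measure. -/
theorem finMeasAdditive (hl : IsFinAddProb l) :
    FinMeasAdditive (0 : Measure Ω) fun s => l s • ContinuousLinearMap.id ℝ ℝ :=
  fun s t hs ht _ _ hst => by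
    dsimp only
    rw [hl.union s hs t ht hst, add_smul]

/-- The integral of a simple function with respect to a finitely additive probability. -/
noncomputable def integral (hl : IsFinAddProb l) : SimpleFunc Ω ℝ →ₗ[ℝ] ℝ where
  toFun f := f.setToSimpleFunc fun s => l s • ContinuousLinearMap.id ℝ ℝ
  map_add' _ _ := SimpleFunc.setToSimpleFunc_add _ hl.finMeasAdditive
    integrable_zero_measure integrable_zero_measure
  map_smul' c _ := SimpleFunc.setToSimpleFunc_smul_real _ hl.finMeasAdditive c
    integrable_zero_measure

theorem integral_apply (hl : IsFinAddProb l) (f : SimpleFunc Ω ℝ) :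
    hl.integral f = ∑ x ∈ f.range, x * l (f ⁻¹' {x}) := by
  simp [integral, SimpleFunc.setToSimpleFunc, mul_comm]

theorem empty (hl : IsFinAddProb l) : l ∅ = 0 := by
  have := hl.union ∅ .empty ∅ .empty (by simp)
  simpa using this

theorem mono (hl : IsFinAddProb l) {A B : Set Ω} (hA : MeasurableSet A) (hB : MeasurableSet B)
    (h : A ⊆ B) : l A ≤ l B := by
  have := hl.union A hA (B \ A) (hB.diff hA) disjoint_sdiff_self_right
  rw [Set.union_sdiff_cancel h] at this
  linarith [hl.nonneg _ (hB.diff hA)]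

theorem compl (hl : IsFinAddProb l) {A : Set Ω} (hA : MeasurableSet A) : l Aᶜ = 1 - l A := by
  have := hl.union A hA Aᶜ hA.compl disjoint_compl_right
  rw [Set.union_compl_self, hl.univ] at this
  linarith

theorem le_one (hl : IsFinAddProb l) {A : Set Ω} (hA : MeasurableSet A) : l A ≤ 1 :=
  hl.univ ▸ hl.mono hA .univ (Set.subset_univ A)

theorem integral_map (hl : IsFinAddProb l) {β : Type*} [NormedAddCommGroup β]
    (f : SimpleFunc Ω β) {g : β → ℝ} (hg : g 0 = 0) :
    hl.integral (f.map g) = ∑ x ∈ f.range, g x * l (f ⁻¹' {x}) := by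
  have := SimpleFunc.map_setToSimpleFunc _ hl.finMeasAdditive (f := f)
    integrable_zero_measure hg
  simpa [integral, mul_comm] using this

theorem integral_mono (hl : IsFinAddProb l) {f g : SimpleFunc Ω ℝ} (h : ∀ x, f x ≤ g x) :
    hl.integral f ≤ hl.integral g := by
  rw [← sub_nonneg, ← map_sub, integral_apply]
  refine Finset.sum_nonneg fun c hc => mul_nonneg ?_ (hl.nonneg _ (SimpleFunc.measurableSet_fiber _ _))
  obtain ⟨x, rfl⟩ := SimpleFunc.mem_range.1 hc
  simpa using h x

theorem nonempty (hl : IsFinAddProb l) : Nonempty Ω := by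
  by_contra h
  rw [not_nonempty_iff] at h
  have := hl.univ
  rw [Set.univ_eq_empty_iff.2 h, hl.empty] at this
  norm_num at this

theorem integral_const (hl : IsFinAddProb l) (c : ℝ) :
    hl.integral (SimpleFunc.const Ω c) = c := by
  have := hl.nonempty
  have h : (SimpleFunc.const Ω c) ⁻¹' {c} = Set.univ := by ext; simp
  rw [integral_apply, SimpleFunc.range_const, Finset.sum_singleton, h, hl.univ, mul_one]

theorem integral_restrict (hl : IsFinAddProb l) (f : SimpleFunc Ω ℝ) {S : Set Ω}
    (hS : MeasurableSet S) :
    hl.integral (f.restrict S) = ∑ x ∈ f.range, x * l (S ∩ f ⁻¹' {x}) := by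
  classical
  -- The restriction may take the value `0` when `f` does not; inserting `0` into the range adds
  -- only a zero term.
  have h1 : hl.integral (f.restrict S) =
      ∑ x ∈ insert 0 f.range, x * l (f.restrict S ⁻¹' {x}) := by
    rw [integral_apply]
    refine Finset.sum_subset (fun x hx => ?_) fun x _ hx => ?_
    · rw [SimpleFunc.mem_restrict_range hS] at hx
      rcases hx with hx | ⟨y, _, rfl⟩
      · simp [hx.1]
      · exact Finset.mem_insert_of_mem (SimpleFunc.mem_range_self f y)
    · rw [SimpleFunc.preimage_eq_empty_iff _ _ |>.2 hx, hl.empty, mul_zero]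
  rw [h1]
  symm
  calc ∑ x ∈ f.range, x * l (S ∩ f ⁻¹' {x})
      = ∑ x ∈ insert 0 f.range, x * l (S ∩ f ⁻¹' {x}) := by
        refine Finset.sum_subset (Finset.subset_insert _ _) fun x hx hx' => ?_
        rw [SimpleFunc.preimage_eq_empty_iff _ _ |>.2 hx', Set.inter_empty, hl.empty, mul_zero]
    _ = _ := by
        refine Finset.sum_congr rfl fun x _ => ?_
        by_cases h0 : x = 0
        · simp [h0]
        · rw [SimpleFunc.restrict_preimage_singleton _ hS h0]

theorem integral_restrict_const (hl : IsFinAddProb l) (c : ℝ) {S : Set Ω}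
    (hS : MeasurableSet S) : hl.integral ((SimpleFunc.const Ω c).restrict S) = c * l S := by
  have := hl.nonempty
  have h : (SimpleFunc.const Ω c) ⁻¹' {c} = Set.univ := by ext; simp
  rw [integral_restrict hl _ hS, SimpleFunc.range_const, Finset.sum_singleton, h, Set.inter_univ]

theorem abs_integral_restrict_le (hl : IsFinAddProb l) {f g : SimpleFunc Ω ℝ}
    (h : ∀ x, |f x| ≤ g x) {S : Set Ω} (hS : MeasurableSet S) :
    |hl.integral (f.restrict S)| ≤ hl.integral g := by
  rw [abs_le, neg_le, ← map_neg]
  constructor <;> refine hl.integral_mono fun x => ?_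
  all_goals
    have := abs_le.1 (h x)
    have h0 := (abs_nonneg _).trans (h x)
    by_cases hx : x ∈ S <;> simp [SimpleFunc.restrict_apply _ hS, hx] <;> linarith

/-- Functions with independent level sets integrate multiplicatively. -/
theorem integral_mul_of_indep (hl : IsFinAddProb l) (f g : SimpleFunc Ω ℝ)
    (h : ∀ x y : ℝ, l (f ⁻¹' {x} ∩ g ⁻¹' {y}) = l (f ⁻¹' {x}) * l (g ⁻¹' {y})) :
    hl.integral (f * g) = hl.integral f * hl.integral g := by
  classical
  have h1 : f * g = (f.pair g).map fun p => p.1 * p.2 := by ext x; simp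
  rw [h1, hl.integral_map _ (by simp), integral_apply, integral_apply, Finset.sum_mul_sum,
    ← Finset.sum_product']
  calc _ = ∑ p ∈ f.range ×ˢ g.range, p.1 * p.2 * l (f.pair g ⁻¹' {p}) := by
        refine Finset.sum_subset (fun p hp => ?_) fun p _ hp => ?_
        · obtain ⟨x, rfl⟩ := SimpleFunc.mem_range.1 hp
          simp
        · rw [SimpleFunc.preimage_eq_empty_iff _ _ |>.2 hp, hl.empty, mul_zero]
    _ = _ := by
        refine Finset.sum_congr rfl fun p _ => ?_
        rw [SimpleFunc.pair_preimage_singleton, h]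
        ring

/-- Markov's inequality. -/
theorem mul_le_integral (hl : IsFinAddProb l) {f : SimpleFunc Ω ℝ} (hf : ∀ x, 0 ≤ f x) (c : ℝ) :
    c * l (f ⁻¹' Set.Ioi c) ≤ hl.integral f := by
  have hS : MeasurableSet (f ⁻¹' Set.Ioi c) := f.measurableSet_preimage _
  rw [← hl.integral_restrict_const c hS]
  refine hl.integral_mono fun x => ?_
  rw [SimpleFunc.restrict_apply _ hS]
  by_cases hx : x ∈ f ⁻¹' Set.Ioi c
  · simpa [hx] using le_of_lt hx
  · simpa [hx] using hf x

/-- A weak law of large numbers: bounded, pairwise independent simple functions. -/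
theorem integral_abs_sum_le (hl : IsFinAddProb l) {ι : Type*} (s : Finset ι)
    (X : ι → SimpleFunc Ω ℝ) {K : ℝ} (h0 : ∀ i x, 0 ≤ X i x) (hK : ∀ i x, X i x ≤ K)
    (hX : ∀ i j, i ≠ j → ∀ x y : ℝ,
      l (X i ⁻¹' {x} ∩ X j ⁻¹' {y}) = l (X i ⁻¹' {x}) * l (X j ⁻¹' {y}))
    {η : ℝ} (hη : 0 < η) :
    hl.integral ((∑ i ∈ s, (X i - SimpleFunc.const Ω (hl.integral (X i)))).map fun x => |x|) ≤
      η + s.card * K ^ 2 / η := by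
  classical
  set Y : ι → SimpleFunc Ω ℝ := fun i => X i - SimpleFunc.const Ω (hl.integral (X i)) with hY
  have hm : ∀ i (c : ℝ), hl.integral (X i * SimpleFunc.const Ω c) = hl.integral (X i) * c := by
    intro i c
    have : X i * SimpleFunc.const Ω c = c • X i := by ext x; simp [mul_comm]
    rw [this, map_smul, smul_eq_mul, mul_comm]
  have hYY : ∀ i j, hl.integral (Y i * Y j) =
      hl.integral (X i * X j) - hl.integral (X i) * hl.integral (X j) := by
    intro i j
    have : Y i * Y j = X i * X j - X i * SimpleFunc.const Ω (hl.integral (X j))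
        - X j * SimpleFunc.const Ω (hl.integral (X i))
        + SimpleFunc.const Ω (hl.integral (X i) * hl.integral (X j)) := by
      ext x
      simp only [hY, SimpleFunc.coe_mul, SimpleFunc.coe_sub, SimpleFunc.coe_add, Pi.mul_apply,
        Pi.sub_apply, Pi.add_apply, SimpleFunc.const_apply]
      ring
    rw [this, map_add, map_sub, map_sub, hm, hm, hl.integral_const]
    ring
  have hoff : ∀ i j, i ≠ j → hl.integral (Y i * Y j) = 0 := by
    intro i j hij
    rw [hYY, hl.integral_mul_of_indep _ _ (hX i j hij), sub_self]
  have hdiag : ∀ i, hl.integral (Y i * Y i) ≤ K ^ 2 := by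
    intro i
    have : hl.integral (X i * X i) ≤ K ^ 2 := by
      rw [← hl.integral_const (K ^ 2)]
      refine hl.integral_mono fun x => ?_
      simp only [SimpleFunc.coe_mul, Pi.mul_apply, SimpleFunc.const_apply]
      nlinarith [h0 i x, hK i x]
    rw [hYY]
    nlinarith [mul_self_nonneg (hl.integral (X i))]
  have hsq : hl.integral ((∑ i ∈ s, Y i) * ∑ i ∈ s, Y i) ≤ s.card * K ^ 2 := by
    rw [Finset.sum_mul_sum, map_sum]
    calc _ ≤ ∑ i ∈ s, K ^ 2 := by
          refine Finset.sum_le_sum fun i hi => ?_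
          rw [map_sum, Finset.sum_eq_single_of_mem i hi fun j _ hj => hoff i j hj.symm]
          exact hdiag i
      _ = _ := by simp
  -- The pointwise bound `|z| ≤ η + z²/η` stands in for the Cauchy–Schwarz inequality.
  calc _ ≤ hl.integral (SimpleFunc.const Ω η + (1 / η) • ((∑ i ∈ s, Y i) * ∑ i ∈ s, Y i)) := by
        refine hl.integral_mono fun x => ?_
        simp only [SimpleFunc.map_apply, SimpleFunc.coe_add, Pi.add_apply, SimpleFunc.const_apply,
          SimpleFunc.coe_smul, Pi.smul_apply, SimpleFunc.coe_mul, Pi.mul_apply, smul_eq_mul]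
        set z := (∑ i ∈ s, Y i) x
        have : η * |z| ≤ η * (η + 1 / η * (z * z)) := by
          have e : η * (η + 1 / η * (z * z)) = η ^ 2 + z * z := by field_simp
          rw [e, ← abs_mul_abs_self z]
          nlinarith [sq_nonneg (η - |z|), sq_nonneg (η + |z|)]
        exact le_of_mul_le_mul_left this hη
    _ ≤ _ := by
        rw [map_add, map_smul, hl.integral_const, smul_eq_mul]
        have : 1 / η * hl.integral ((∑ i ∈ s, Y i) * ∑ i ∈ s, Y i) ≤ 1 / η * (s.card * K ^ 2) :=
          mul_le_mul_of_nonneg_left hsq (by positivity)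
        calc _ ≤ η + 1 / η * (s.card * K ^ 2) := by linarith
          _ = _ := by ring

end IsFinAddProb

end FiniteAdditiveIntegral

/-! ### Extraction of a subsequence. -/

/-- A bounded double sequence has a subsequence along which every column converges, at a uniform
rate, and whose limit in a given column is at least any value that is frequently exceeded there. -/
theorem exists_subseq_columns_tendsto (a : ℕ → ℕ → ℝ) {C r : ℝ} (h0 : ∀ n k, 0 ≤ a n k)
    (hC : ∀ n k, a n k ≤ C) (hmono : ∀ n, Monotone (a n)) (k₀ : ℕ)
    (hr : ∃ᶠ n in atTop, r < a n k₀) :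
    ∃ (d : ℕ → ℝ) (φ : ℕ → ℕ), StrictMono φ ∧ Monotone d ∧ (∀ k, 0 ≤ d k ∧ d k ≤ C) ∧ r ≤ d k₀ ∧
      ∀ n, ∀ k ≤ n, |a (φ n) k - d k| ≤ 1 / ((n : ℝ) + 1) := by
  have : NeBot (atTop ⊓ 𝓟 {n | r < a n k₀}) := by
    rw [← frequently_mem_iff_neBot]; exact hr
  -- One ultrafilter gives limits of all columns at once. Since it contains the set where column
  -- `k₀` exceeds `r`, the bound `r ≤ d k₀` survives in the limit.
  set U : Ultrafilter ℕ := Ultrafilter.of (atTop ⊓ 𝓟 {n | r < a n k₀}) with hU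
  have hUle : (U : Filter ℕ) ≤ atTop ⊓ 𝓟 {n | r < a n k₀} := Ultrafilter.of_le _
  have hUr : ∀ᶠ n in (U : Filter ℕ), r < a n k₀ :=
    le_principal_iff.1 (hUle.trans inf_le_right)
  have hex : ∀ k, ∃ x ∈ Set.Icc 0 C, Tendsto (fun n => a n k) U (𝓝 x) := by
    intro k
    have := isCompact_Icc (a := (0 : ℝ)) (b := C) |>.ultrafilter_le_nhds (U.map fun n => a n k)
      (by
        rw [le_principal_iff, Ultrafilter.mem_coe, Ultrafilter.mem_map]
        exact Filter.univ_mem' fun n => ⟨h0 n k, hC n k⟩)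
    exact this
  choose d hd hlim using hex
  -- Finitely many closeness conditions hold eventually along `U ≤ atTop`, hence frequently along
  -- `atTop`, which suffices to pick `φ` inductively.
  have hP : ∀ n : ℕ, ∃ᶠ m in atTop, ∀ k ≤ n, |a m k - d k| ≤ 1 / ((n : ℝ) + 1) := by
    intro n
    have : ∀ᶠ m in (U : Filter ℕ), ∀ k ∈ Set.Iic n, |a m k - d k| ≤ 1 / ((n : ℝ) + 1) := by
      rw [eventually_all_finite (Set.finite_Iic n)]
      intro k _
      have := (hlim k).eventually (Metric.closedBall_mem_nhds (d k)
        (show (0 : ℝ) < 1 / ((n : ℝ) + 1) by positivity))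
      simpa [Metric.mem_closedBall, Real.dist_eq] using this
    exact this.frequently.filter_mono (hUle.trans inf_le_left)
  obtain ⟨φ, hφ, hφP⟩ := extraction_forall_of_frequently hP
  refine ⟨d, φ, hφ, fun k k' hk => ?_, hd, ?_, hφP⟩
  · exact le_of_tendsto_of_tendsto' (hlim k) (hlim k') fun n => hmono n hk
  · exact ge_of_tendsto (hlim k₀) (hUr.mono fun n hn => hn.le)

/-! ### Independent simple functions: exceptional sets and averages. -/

section IndependentLevelSets

variable {Ω : Type*} [MeasurableSpace Ω] {l : Set Ω → ℝ}

/-- Independence of a sequence of simple functions, with countable intersections of level sets. -/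
def IndepLevels (l : Set Ω → ℝ) (h : ℕ → SimpleFunc Ω ℝ) : Prop :=
  ∀ s : ℕ → Set ℝ, HasProd (fun i => l (h i ⁻¹' s i)) (l (⋂ i, h i ⁻¹' s i))

namespace IndepLevels

theorem map {h : ℕ → SimpleFunc Ω ℝ} (hh : IndepLevels l h) (g : ℕ → ℝ → ℝ) :
    IndepLevels l fun i => (h i).map (g i) := by
  intro s
  simpa [SimpleFunc.coe_map, Set.preimage_comp] using hh fun i => g i ⁻¹' s i

/-- Indices outside the range of `φ` are given the level set `univ`, which contributes a factor `1`
and leaves the intersection unchanged. -/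
theorem comp_injective {h : ℕ → SimpleFunc Ω ℝ} (hl : IsFinAddProb l) (hh : IndepLevels l h)
    {φ : ℕ → ℕ} (hφ : φ.Injective) : IndepLevels l fun i => h (φ i) := by
  intro s
  have := hh (Function.extend φ s fun _ => Set.univ)
  rw [← hφ.hasProd_iff] at this
  · convert this using 2
    · simp [hφ.extend_apply]
    · ext x
      simp only [Set.mem_iInter, Set.mem_preimage]
      refine ⟨fun hx j => ?_, fun hx i => by simpa [hφ.extend_apply] using hx (φ i)⟩
      by_cases hj : ∃ i, φ i = j
      · obtain ⟨i, rfl⟩ := hj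
        simpa [hφ.extend_apply] using hx i
      · rw [Function.extend_apply' _ _ _ hj]
        trivial
  · intro j hj
    rw [Function.extend_apply' _ _ _ (by simpa using hj), Set.preimage_univ, hl.univ]

theorem pair {h : ℕ → SimpleFunc Ω ℝ} (hl : IsFinAddProb l) (hh : IndepLevels l h)
    {i j : ℕ} (hij : i ≠ j) (s t : Set ℝ) :
    l (h i ⁻¹' s ∩ h j ⁻¹' t) = l (h i ⁻¹' s) * l (h j ⁻¹' t) := by
  classical
  have h1 := hh fun m => if m = i then s else if m = j then t else Set.univ
  have h2 := hasProd_prod_of_ne_finset_one (s := {i, j})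
    (f := fun m => l (h m ⁻¹' (if m = i then s else if m = j then t else Set.univ)))
    (L := SummationFilter.unconditional ℕ) (by
      intro m hm
      simp only [Finset.mem_insert, Finset.mem_singleton, not_or] at hm
      simp [hm.1, hm.2, hl.univ])
  have h3 := h1.unique h2
  rw [Finset.prod_pair hij] at h3
  simp only [if_true, if_neg hij.symm] at h3
  rw [← h3]
  congr 1
  ext x
  simp only [Set.mem_inter_iff, Set.mem_iInter, Set.mem_preimage]
  refine ⟨fun hx m => ?_, fun hx => ⟨by simpa using hx i, by simpa [hij.symm] using hx j⟩⟩
  split_ifs with h1 h2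
  · exact h1 ▸ hx.1
  · exact h2 ▸ hx.2
  · trivial

/-- The bound of Borel–Cantelli type that replaces countable subadditivity. -/
theorem le_iInter_level {h : ℕ → SimpleFunc Ω ℝ} (hl : IsFinAddProb l) (hh : IndepLevels l h)
    (hpos : ∀ i x, 0 ≤ h i x) {C : ℝ} (hC : ∀ i, hl.integral (h i) ≤ C) (N : ℕ) :
    1 - 2 * C / 2 ^ N ≤
      l (⋂ i, h i ⁻¹' (if N ≤ i then Set.Iic (2 ^ i) else Set.univ)) := by
  set p : ℕ → ℝ := fun i => l (h i ⁻¹' (if N ≤ i then Set.Iic (2 ^ i) else Set.univ)) with hp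
  have hp0 : ∀ i, 0 ≤ p i := fun i => hl.nonneg _ ((h i).measurableSet_preimage _)
  have hp1 : ∀ i, p i ≤ 1 := fun i => hl.le_one ((h i).measurableSet_preimage _)
  have hC0 : 0 ≤ C := by
    refine le_trans ?_ (hC 0)
    rw [← map_zero hl.integral]
    exact hl.integral_mono fun x => by simpa using hpos 0 x
  have hpN : ∀ i, N ≤ i → 1 - C / 2 ^ i ≤ p i := by
    intro i hi
    have h1 := (hl.mul_le_integral (hpos i) (2 ^ i)).trans (hC i)
    have h2 := hl.compl ((h i).measurableSet_preimage (Set.Ioi (2 ^ i)))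
    rw [← Set.preimage_compl, Set.compl_Ioi] at h2
    simp only [hp, if_pos hi, h2]
    have : l (h i ⁻¹' Set.Ioi (2 ^ i)) ≤ C / 2 ^ i := by
      rw [le_div_iff₀ (by positivity), mul_comm]
      exact h1
    linarith
  -- The extra `2C/2^n` makes the induction close: it drops by exactly `C/2^n` at each step, and the
  -- partial product, being at most `1`, loses no more than that.
  have hind : ∀ n, N ≤ n → 1 - 2 * C / 2 ^ N + 2 * C / 2 ^ n ≤ ∏ i ∈ Finset.range n, p i := by
    intro n hn
    induction n, hn using Nat.le_induction with
    | base =>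
      rw [Finset.prod_eq_one]
      · linarith
      · intro i hi
        have : ¬ N ≤ i := by simpa using hi
        simp [hp, this, hl.univ]
    | succ n hn ih =>
      rw [Finset.prod_range_succ]
      have hP1 : ∏ i ∈ Finset.range n, p i ≤ 1 := Finset.prod_le_one (fun i _ => hp0 i)
        fun i _ => hp1 i
      have hP0 : 0 ≤ ∏ i ∈ Finset.range n, p i := Finset.prod_nonneg fun i _ => hp0 i
      have e : 2 * C / 2 ^ (n + 1) = 2 * C / 2 ^ n - C / 2 ^ n := by
        rw [pow_succ]; field_simp; ring
      rw [e]
      nlinarith [hpN n hn, hp1 n]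
  -- Countable independence replaces continuity from above here: the partial products converge to
  -- the value of `l` on the infinite intersection.
  refine ge_of_tendsto (hh _).tendsto_prod_nat ?_
  filter_upwards [eventually_ge_atTop N] with n hn
  refine le_trans ?_ (hind n hn)
  have : 0 ≤ 2 * C / 2 ^ n := by positivity
  linarith

end IndepLevels

theorem restrict_sum_simpleFunc {ι : Type*} (s : Finset ι) (f : ι → SimpleFunc Ω ℝ) {S : Set Ω}
    (hS : MeasurableSet S) : (∑ i ∈ s, f i).restrict S = ∑ i ∈ s, (f i).restrict S := by
  classical
  induction s using Finset.induction_on with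
  | empty => ext x; simp [SimpleFunc.restrict_apply _ hS]
  | insert a s ha ih =>
    rw [Finset.sum_insert ha, Finset.sum_insert ha, ← ih]
    ext x
    by_cases hx : x ∈ S <;> simp [SimpleFunc.restrict_apply _ hS, hx]

/-- Averages of independent functions, cut off at levels where their truncated means converge,
converge to the limit of these means in the mean. -/
theorem IndepLevels.eventually_abs_average_sub_le {h : ℕ → SimpleFunc Ω ℝ} (hl : IsFinAddProb l)
    (hh : IndepLevels l h) (hpos : ∀ i x, 0 ≤ h i x) {d : ℕ → ℝ} {D : ℝ} (hmono : Monotone d)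
    (hdD : Tendsto d atTop (𝓝 D))
    (had : ∀ i, ∀ k ≤ i,
      |hl.integral ((h i).map fun x => min x (2 ^ k)) - d k| ≤ 1 / ((i : ℝ) + 1))
    {ε : ℝ} (hε : 0 < ε) :
    ∀ᶠ n : ℕ in atTop, ∀ S, MeasurableSet S → (∀ i, n ≤ i → ∀ x ∈ S, h i x ≤ 2 ^ i) →
      |((n : ℝ) + 1)⁻¹ * ∑ i ∈ Finset.Icc n (2 * n), hl.integral ((h i).restrict S) - D * l S|
        ≤ ε := by
  -- The level `k` is fixed before `n`. The tail part and the constant part then cost `ε/8` each,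
  -- the weak law `ε/2`, and the convergence rates `3/(n+1) < ε/4`.
  obtain ⟨k, hk⟩ := (hdD.eventually (lt_mem_nhds (show D - ε / 8 < D by linarith))).exists
  have hdle : ∀ i, d i ≤ D := fun i => hmono.ge_of_tendsto hdD i
  have ht : ∀ c : ℝ, Tendsto (fun n : ℕ => c / ((n : ℝ) + 1)) atTop (𝓝 0) := fun c => by
    have := (tendsto_one_div_add_atTop_nhds_zero_nat (𝕜 := ℝ)).const_mul c
    simpa [div_eq_mul_inv] using this
  filter_upwards [eventually_ge_atTop k,
    (ht 3).eventually (gt_mem_nhds (show (0 : ℝ) < ε / 4 by linarith)),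
    (ht ((2 ^ k) ^ 2 / (ε / 4))).eventually (gt_mem_nhds (show (0 : ℝ) < ε / 4 by linarith))]
    with n hn h3 hη S hS hSle
  set s := Finset.Icc n (2 * n) with hs
  have hcard : (s.card : ℝ) = (n : ℝ) + 1 := by
    rw [hs, Nat.card_Icc]
    have : 2 * n + 1 - n = n + 1 := by omega
    rw [this]; push_cast; ring
  have hn0 : (0 : ℝ) < (n : ℝ) + 1 := by positivity
  set X : ℕ → ℕ → SimpleFunc Ω ℝ := fun i k => (h i).map fun x => min x (2 ^ k) with hX
  set a : ℕ → ℕ → ℝ := fun i k => hl.integral (X i k) with ha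
  have hbound : ∀ i ∈ s, 1 / ((i : ℝ) + 1) ≤ 1 / ((n : ℝ) + 1) := by
    intro i hi
    have : (n : ℝ) ≤ i := by exact_mod_cast (Finset.mem_Icc.1 hi).1
    exact one_div_le_one_div_of_le hn0 (by linarith)
  -- On `S` the cut-off gives `h i = X i i`, which splits as tail above level `2^k`, plus centred
  -- truncation, plus a constant near `D`.
  have hsplit : ∀ i ∈ s, hl.integral ((h i).restrict S) - D * l S =
      hl.integral ((X i i - X i k).restrict S)
      + hl.integral ((X i k - SimpleFunc.const Ω (a i k)).restrict S)
      + hl.integral ((SimpleFunc.const Ω (a i k - D)).restrict S) := by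
    intro i hi
    rw [← hl.integral_restrict_const D hS, ← map_sub, ← map_add, ← map_add]
    congr 1
    ext x
    by_cases hx : x ∈ S
    · have := hSle i (Finset.mem_Icc.1 hi).1 x hx
      simp [SimpleFunc.restrict_apply _ hS, hx, hX, min_eq_left this]
    · simp [SimpleFunc.restrict_apply _ hS, hx]
  have hsum : ∑ i ∈ s, (hl.integral ((h i).restrict S) - D * l S) =
      ∑ i ∈ s, hl.integral ((X i i - X i k).restrict S)
      + hl.integral ((∑ i ∈ s, (X i k - SimpleFunc.const Ω (a i k))).restrict S)
      + ∑ i ∈ s, hl.integral ((SimpleFunc.const Ω (a i k - D)).restrict S) := by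
    rw [Finset.sum_congr rfl hsplit, Finset.sum_add_distrib, Finset.sum_add_distrib,
      restrict_sum_simpleFunc _ _ hS, map_sum]
  have b1 : |∑ i ∈ s, hl.integral ((X i i - X i k).restrict S)| ≤
      ((n : ℝ) + 1) * (ε / 8 + 2 / ((n : ℝ) + 1)) := by
    refine (Finset.abs_sum_le_sum_abs _ _).trans ?_
    rw [← hcard, ← nsmul_eq_mul]
    refine Finset.sum_le_card_nsmul _ _ _ fun i hi => ?_
    have hki : k ≤ i := hn.trans (Finset.mem_Icc.1 hi).1
    refine (hl.abs_integral_restrict_le (g := X i i - X i k) (fun x => ?_) hS).trans ?_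
    · refine (abs_of_nonneg ?_).le
      simp only [hX, SimpleFunc.coe_sub, Pi.sub_apply, SimpleFunc.map_apply, sub_nonneg]
      exact min_le_min_left _ (pow_le_pow_right₀ (by norm_num) hki)
    · rw [map_sub, hcard]
      have e1 := (abs_le.1 (had i i le_rfl)).2
      have e2 := (abs_le.1 (had i k hki)).1
      have e3 := hbound i hi
      have e4 := hdle i
      have e5 : 2 / ((n : ℝ) + 1) = 1 / ((n : ℝ) + 1) + 1 / ((n : ℝ) + 1) := by ring
      linarith
  have b3 : |∑ i ∈ s, hl.integral ((SimpleFunc.const Ω (a i k - D)).restrict S)| ≤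
      ((n : ℝ) + 1) * (ε / 8 + 1 / ((n : ℝ) + 1)) := by
    refine (Finset.abs_sum_le_sum_abs _ _).trans ?_
    rw [← hcard, ← nsmul_eq_mul]
    refine Finset.sum_le_card_nsmul _ _ _ fun i hi => ?_
    have hki : k ≤ i := hn.trans (Finset.mem_Icc.1 hi).1
    rw [hl.integral_restrict_const _ hS, abs_mul, abs_of_nonneg (hl.nonneg _ hS), hcard]
    refine (mul_le_of_le_one_right (abs_nonneg _) (hl.le_one hS)).trans ?_
    have e1 := abs_le.1 (had i k hki)
    have e3 := hbound i hi
    have e4 := hdle k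
    rw [abs_le]
    constructor <;> linarith [e1.1, e1.2]
  have b2 : |hl.integral ((∑ i ∈ s, (X i k - SimpleFunc.const Ω (a i k))).restrict S)| ≤
      ((n : ℝ) + 1) * (ε / 4 + ε / 4) := by
    refine (hl.abs_integral_restrict_le (g := (∑ i ∈ s,
      (X i k - SimpleFunc.const Ω (a i k))).map fun x => |x|) (fun x => by simp) hS).trans ?_
    have hXi : IndepLevels l fun i => X i k := hh.map fun _ x => min x (2 ^ k)
    refine (hl.integral_abs_sum_le s (fun i => X i k) (K := 2 ^ k) (fun i x => ?_) (fun i x => ?_)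
      (fun i j hij x y => hXi.pair hl hij {x} {y})
      -- With `η` proportional to `n + 1` the variance term stays bounded by `(2^k)²/(ε/4)`, which
      -- is `o(n)`.
      (η := ((n : ℝ) + 1) * (ε / 4)) (by positivity)).trans ?_
    · simp [hX, hpos i x]
    · simp [hX]
    · rw [hcard, mul_add]
      gcongr
      rw [mul_div_mul_left _ _ hn0.ne']
      have := hη.le
      rw [div_le_iff₀ hn0] at this
      linarith
  have hfin : ((n : ℝ) + 1)⁻¹ * ∑ i ∈ s, hl.integral ((h i).restrict S) - D * l S =
      ((n : ℝ) + 1)⁻¹ * ∑ i ∈ s, (hl.integral ((h i).restrict S) - D * l S) := by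
    rw [Finset.sum_sub_distrib, Finset.sum_const, nsmul_eq_mul, hcard]
    field_simp
  rw [hfin, abs_mul, abs_of_pos (inv_pos.2 hn0), hsum, inv_mul_le_iff₀ hn0]
  refine (abs_add_three _ _ _).trans ((add_le_add (add_le_add b1 b2) b3).trans ?_)
  rw [← mul_add, ← mul_add]
  refine mul_le_mul_of_nonneg_left ?_ hn0.le
  have e5 : 3 / ((n : ℝ) + 1) = 2 / ((n : ℝ) + 1) + 1 / ((n : ℝ) + 1) := by ring
  linarith

/-- Subsequence splitting and averaging for independent nonnegative simple functions with bounded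
integrals. -/
theorem IndepLevels.exists_average_limit {h : ℕ → SimpleFunc Ω ℝ} (hl : IsFinAddProb l)
    (hh : IndepLevels l h) (hpos : ∀ i x, 0 ≤ h i x) {C : ℝ} (hC : ∀ i, hl.integral (h i) ≤ C)
    {r : ℝ} (k₀ : ℕ)
    (hr : ∃ᶠ n in atTop, r < hl.integral ((h n).map fun x => min x (2 ^ k₀))) :
    ∃ (D : ℝ) (φ : ℕ → ℕ) (A : ℕ → Set Ω), StrictMono φ ∧ 0 ≤ D ∧ r ≤ D ∧
      (∀ N, MeasurableSet (A N)) ∧ Tendsto (fun N => l (A N)ᶜ) atTop (𝓝 0) ∧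
      ∀ N, ∀ ε : ℝ, 0 < ε → ∀ᶠ n : ℕ in atTop, ∀ S, MeasurableSet S → S ⊆ A N →
        |((n : ℝ) + 1)⁻¹ * ∑ i ∈ Finset.Icc n (2 * n), hl.integral ((h (φ i)).restrict S) - D * l S|
          ≤ ε := by
  obtain ⟨d, φ, hφ, hdm, hdb, hrd, hclose⟩ := exists_subseq_columns_tendsto
    (fun n k => hl.integral ((h n).map fun x => min x (2 ^ k))) (C := C) (r := r)
    (fun n k => by
      rw [← map_zero hl.integral]
      exact hl.integral_mono fun x => by simp [hpos n x])
    (fun n k => (hl.integral_mono fun x => by simp).trans (hC n))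
    (fun n k k' hk => hl.integral_mono fun x => by
      simp only [SimpleFunc.map_apply]
      exact min_le_min_left _ (pow_le_pow_right₀ (by norm_num) hk)) k₀ hr
  have hbdd : BddAbove (Set.range d) := ⟨C, by rintro _ ⟨k, rfl⟩; exact (hdb k).2⟩
  have hind : IndepLevels l fun i => h (φ i) := hh.comp_injective hl hφ.injective
  set A : ℕ → Set Ω := fun N =>
    ⋂ i, h (φ i) ⁻¹' (if N ≤ i then Set.Iic (2 ^ i) else Set.univ) with hA
  have hAm : ∀ N, MeasurableSet (A N) := fun N =>
    MeasurableSet.iInter fun i => (h (φ i)).measurableSet_preimage _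
  refine ⟨⨆ k, d k, φ, A, hφ, (hdb 0).1.trans (le_ciSup hbdd 0), hrd.trans (le_ciSup hbdd k₀), hAm,
    ?_, fun N ε hε => ?_⟩
  · refine squeeze_zero (fun N => hl.nonneg _ (hAm N).compl) (g := fun N => 2 * C * (1 / 2) ^ N)
      (fun N => ?_) ?_
    · have := hind.le_iInter_level hl (fun i => hpos _) (fun i => hC _) N
      rw [hl.compl (hAm N)]
      have e : 2 * C * (1 / 2) ^ N = 2 * C / 2 ^ N := by rw [one_div, inv_pow]; rfl
      rw [e]
      linarith
    · simpa using (tendsto_pow_atTop_nhds_zero_of_lt_one (r := (1 / 2 : ℝ)) (by norm_num)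
        (by norm_num)).const_mul (2 * C)
  · filter_upwards [hind.eventually_abs_average_sub_le hl (fun i => hpos _) hdm
      (tendsto_atTop_ciSup hdm hbdd) hclose hε, eventually_ge_atTop N] with n hn hNn S hS hSA
    refine hn S hS fun i hi x hx => ?_
    have := Set.mem_iInter.1 (hSA hx) i
    simpa [hNn.trans hi] using this

end IndependentLevelSets

/-! ### Elementary bounds for the variation. -/

section Variation

variable {Ω : Type*} {𝓐 : Set (Set Ω)}

theorem variation_nonneg (μ : Set Ω → ℝ) (A : Set Ω) : 0 ≤ variation 𝓐 μ A := by
  refine Real.sSup_nonneg ?_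
  rintro _ ⟨π, _, rfl⟩
  exact Finset.sum_nonneg fun _ _ => abs_nonneg _

theorem abs_le_tvNorm (h𝓐 : IsSetAlgebra 𝓐) {μ : Set Ω → ℝ} (hμ : μ ∈ ba 𝓐) {A : Set Ω}
    (hA : A ∈ 𝓐) : |μ A| ≤ tvNorm 𝓐 μ := by
  classical
  obtain ⟨_, _, C, hC⟩ := hμ
  have hπ : ({A, Aᶜ} : Finset (Set Ω)) ∈ finPartitions 𝓐 := by
    refine ⟨by simp [hA, h𝓐.compl_mem hA], ?_, by simp⟩
    rw [Finset.coe_pair]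
    exact Set.pairwise_pair_of_symm.2 fun _ => disjoint_compl_right
  have h1 : |μ A| ≤ ∑ E ∈ ({A, Aᶜ} : Finset (Set Ω)), |μ (Set.univ ∩ E)| := by
    simp only [Set.univ_inter]
    exact Finset.single_le_sum (f := fun E => |μ E|) (fun _ _ => abs_nonneg _) (by simp)
  refine h1.trans (le_csSup ⟨C, ?_⟩ ⟨_, hπ, rfl⟩)
  rintro _ ⟨π, hπ, rfl⟩
  simpa using hC π hπ

/-- The positive terms of a partition sum add up to `μ` of a single subset of `A`, and so do the
negative ones; each group contributes at most `c`. -/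
theorem variation_le_of_abs_le (h𝓐 : IsSetAlgebra 𝓐) {μ : Set Ω → ℝ}
    (hadd : ∀ A ∈ 𝓐, ∀ B ∈ 𝓐, Disjoint A B → μ (A ∪ B) = μ A + μ B) {A : Set Ω} (hA : A ∈ 𝓐)
    {c : ℝ} (hc : ∀ S ∈ 𝓐, S ⊆ A → |μ S| ≤ c) : variation 𝓐 μ A ≤ c + c := by
  classical
  have hc0 : 0 ≤ c := (abs_nonneg _).trans (hc A hA subset_rfl)
  refine Real.sSup_le ?_ (by linarith)
  rintro _ ⟨π, hπ, rfl⟩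
  have hadd' : ∀ B ∈ 𝓐, ∀ B' ∈ 𝓐, Disjoint B B' →
      μ (A ∩ (B ∪ B')) = μ (A ∩ B) + μ (A ∩ B') := fun B hB B' hB' hd => by
    rw [Set.inter_union_distrib_left]
    exact hadd _ (h𝓐.inter_mem hA hB) _ (h𝓐.inter_mem hA hB')
      (hd.mono Set.inter_subset_right Set.inter_subset_right)
  have key : ∀ (p : Set Ω → Prop) [DecidablePred p], |∑ E ∈ π.filter p, μ (A ∩ E)| ≤ c :=
      fun p _ => by
    have := sum_eq_biUnion h𝓐 (μ := fun E => μ (A ∩ E)) hadd' (π.filter p)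
      (fun E hE => hπ.1 E (Finset.mem_filter.1 hE).1)
      (hπ.2.1.subset (by exact_mod_cast Finset.filter_subset p π))
    rw [this.2]
    exact hc _ (h𝓐.inter_mem hA this.1) Set.inter_subset_left
  dsimp only
  rw [← Finset.sum_filter_add_sum_filter_not π (fun E => 0 ≤ μ (A ∩ E))]
  refine add_le_add ?_ ?_
  · rw [Finset.sum_congr rfl (g := fun E => μ (A ∩ E))
      (fun E hE => abs_of_nonneg (Finset.mem_filter.1 hE).2)]
    exact (le_abs_self _).trans (key _)
  · rw [Finset.sum_congr rfl (g := fun E => -μ (A ∩ E))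
      (fun E hE => abs_of_neg (not_le.1 (Finset.mem_filter.1 hE).2)), Finset.sum_neg_distrib]
    exact (neg_le_abs _).trans (key _)

theorem tvNorm_le_of_nonneg (h𝓐 : IsSetAlgebra 𝓐) {μ : Set Ω → ℝ} (hμ : μ ∈ ba 𝓐)
    (h0 : ∀ A, 0 ≤ μ A) : tvNorm 𝓐 μ ≤ μ Set.univ := by
  refine Real.sSup_le ?_ (h0 _)
  rintro _ ⟨π, hπ, rfl⟩
  have := (sum_eq_biUnion h𝓐 hμ.2.1 π hπ.1 hπ.2.1).2
  have hU : (⋃ E ∈ π, E) = Set.univ := by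
    rw [← hπ.2.2, Set.sUnion_eq_biUnion]; rfl
  rw [hU] at this
  simp only [Set.univ_inter]
  rw [← this]
  exact (Finset.sum_congr rfl fun E _ => abs_of_nonneg (h0 E)).le

theorem preimage_mem_of_mem_Sim (h𝓐 : IsSetAlgebra 𝓐) {h : Ω → ℝ} (hh : h ∈ Sim 𝓐)
    (s : Set ℝ) : h ⁻¹' s ∈ 𝓐 := by
  have hf : (Set.range h ∩ s).Finite := hh.1.inter_of_left s
  have : h ⁻¹' s = ⋃ c ∈ hf.toFinset, h ⁻¹' {c} := by
    ext x
    simp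
  rw [this]
  exact h𝓐.biUnion_mem _ fun c _ => hh.2 c

end Variation

/-! ### From simple functions back to set functions. -/

section MeasurableSets

variable {Ω : Type*} [MeasurableSpace Ω]

theorem isSetAlgebra_measurableSet : IsSetAlgebra {A : Set Ω | MeasurableSet A} where
  empty_mem := MeasurableSet.empty
  compl_mem := fun _ h => MeasurableSet.compl h
  union_mem := fun _ _ h h' => MeasurableSet.union h h'

theorem IsFinAddProb.of_mem_Prob {lam : ba {A : Set Ω | MeasurableSet A}}
    (h : lam ∈ Prob {A : Set Ω | MeasurableSet A}) : IsFinAddProb (lam : Set Ω → ℝ) :=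
  ⟨fun A _ => h.1 A, lam.2.2.1, h.2⟩

variable {l : Set Ω → ℝ}

theorem density_eq_integral_restrict (hl : IsFinAddProb l) (f : SimpleFunc Ω ℝ) {S : Set Ω}
    (hS : MeasurableSet S) :
    density {A : Set Ω | MeasurableSet A} l f S = hl.integral (f.restrict S) := by
  rw [density, if_pos (show S ∈ {A : Set Ω | MeasurableSet A} from hS), hl.integral_restrict f hS, ← SimpleFunc.coe_range,
    finsum_mem_coe_finset]

theorem density_mem_ba (hl : IsFinAddProb l) (f : SimpleFunc Ω ℝ) :
    density {A : Set Ω | MeasurableSet A} l f ∈ ba {A : Set Ω | MeasurableSet A} := by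
  refine mem_ba_of_bounded isSetAlgebra_measurableSet (C := hl.integral (f.map fun x => |x|))
    (fun A hA => if_neg hA) (fun A hA B hB hAB => ?_) fun A hA => ?_
  · have hA' : MeasurableSet A := hA
    have hB' : MeasurableSet B := hB
    rw [density_eq_integral_restrict hl f hA', density_eq_integral_restrict hl f hB',
      density_eq_integral_restrict hl f (hA'.union hB'), ← map_add]
    congr 1
    ext x
    by_cases hx : x ∈ A
    · simp [SimpleFunc.restrict_apply _, hA', hB', hA'.union hB', hx, Set.disjoint_left.1 hAB hx]
    · by_cases hx' : x ∈ B <;>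
        simp [SimpleFunc.restrict_apply _, hA', hB', hA'.union hB', hx, hx']
  · rw [density_eq_integral_restrict hl f hA]
    exact hl.abs_integral_restrict_le (fun x => by simp) hA

/-- Replacing the density by its positive part at most doubles the error of approximation to a
nonnegative set function. -/
theorem abs_sub_integral_posPart_le (hl : IsFinAddProb l) {μ : Set Ω → ℝ}
    (h0 : ∀ A, 0 ≤ μ A) (f : SimpleFunc Ω ℝ) {e : ℝ}
    (he : ∀ S, MeasurableSet S → |μ S - hl.integral (f.restrict S)| ≤ e) {S : Set Ω}
    (hS : MeasurableSet S) :
    |μ S - hl.integral ((f.map fun x => max x 0).restrict S)| ≤ 2 * e := by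
  -- On `S` the positive part is `f` minus its restriction to `T`, and `0 ≥ ∫_T f ≥ μ T - e ≥ -e`.
  set T := S ∩ f ⁻¹' Set.Iio 0 with hT
  have hTm : MeasurableSet T := hS.inter (f.measurableSet_preimage _)
  have h1 : (f.map fun x => max x 0).restrict S = f.restrict S - f.restrict T := by
    ext x
    rw [SimpleFunc.coe_sub, Pi.sub_apply, SimpleFunc.restrict_apply _ hS,
      SimpleFunc.restrict_apply _ hS, SimpleFunc.restrict_apply _ hTm]
    by_cases hx : x ∈ S
    · by_cases hx0 : f x < 0
      · simp [hT, hx, hx0, hx0.le]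
      · simp [hT, hx, hx0, not_lt.1 hx0]
    · simp [hT, hx]
  have h2 : hl.integral (f.restrict T) ≤ 0 := by
    rw [← map_zero hl.integral]
    refine hl.integral_mono fun x => ?_
    rw [SimpleFunc.restrict_apply _ hTm]
    exact Set.indicator_apply_le' (fun hx => le_of_lt hx.2) fun _ => le_rfl
  have h3 := abs_le.1 (he S hS)
  have h4 := abs_le.1 (he T hTm)
  have h5 := h0 T
  rw [h1, map_sub, abs_le]
  constructor <;> linarith [h3.1, h3.2, h4.2]

/-- The set `B = {f ≤ K}` competes in the infimum defining the meet at `univ`, and `μ B + K * l Bᶜ`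
differs from `∫ min f K` only by the error of approximating `μ B`. -/
theorem tvNorm_meet_le (hl : IsFinAddProb l) {μ : Set Ω → ℝ}
    (hμ : μ ∈ ba {A : Set Ω | MeasurableSet A}) (hl' : l ∈ ba {A : Set Ω | MeasurableSet A})
    (h0 : ∀ A, 0 ≤ μ A) (h0l : ∀ A, 0 ≤ l A) (f : SimpleFunc Ω ℝ) {e : ℝ}
    (he : ∀ S, MeasurableSet S → |μ S - hl.integral (f.restrict S)| ≤ e) {K : ℝ} (hK : 0 ≤ K) :
    tvNorm {A : Set Ω | MeasurableSet A} (meet {A : Set Ω | MeasurableSet A} μ (K • l)) ≤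
      hl.integral (f.map fun x => min x K) + e := by
  have hKl : K • l ∈ ba {A : Set Ω | MeasurableSet A} := Submodule.smul_mem _ _ hl'
  have hm := meet_mem_ba isSetAlgebra_measurableSet hμ hKl
  have hm0 : ∀ A, 0 ≤ meet {A : Set Ω | MeasurableSet A} μ (K • l) A := by
    intro A
    rw [meet]
    split_ifs
    · refine Real.sInf_nonneg ?_
      rintro _ ⟨B, _, rfl⟩
      exact add_nonneg (h0 _) (mul_nonneg hK (h0l _))
    · exact le_rfl
  refine (tvNorm_le_of_nonneg isSetAlgebra_measurableSet hm hm0).trans ?_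
  set B : Set Ω := f ⁻¹' Set.Iic K with hB
  have hBm : MeasurableSet B := f.measurableSet_preimage _
  have h1 : meet {A : Set Ω | MeasurableSet A} μ (K • l) Set.univ ≤ μ B + K * l Bᶜ := by
    rw [meet, if_pos (show Set.univ ∈ {A : Set Ω | MeasurableSet A} from MeasurableSet.univ)]
    rw [Set.compl_eq_univ_sdiff]
    refine csInf_le ⟨0, ?_⟩ ⟨B, ⟨hBm, Set.subset_univ _⟩, rfl⟩
    rintro _ ⟨B, _, rfl⟩
    exact add_nonneg (h0 _) (mul_nonneg hK (h0l _))
  have h2 : f.map (fun x => min x K) =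
      f.restrict B + (SimpleFunc.const Ω K).restrict Bᶜ := by
    ext x
    rw [SimpleFunc.coe_add, Pi.add_apply, SimpleFunc.restrict_apply _ hBm,
      SimpleFunc.restrict_apply _ hBm.compl]
    by_cases hx : f x ≤ K
    · simp [hB, hx]
    · simp [hB, hx, (not_le.1 hx).le]
  rw [h2, map_add, hl.integral_restrict_const K hBm.compl]
  linarith [(abs_le.1 (he B hBm)).2]

/-- Convergence of convex combinations for set functions approximated by independent densities. -/
theorem exists_convexHull_limit (F : ℕ → ba {A : Set Ω | MeasurableSet A}) (hF : ∀ n, 0 ≤ F n)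
    (hF_bdd : ∃ C : ℝ, ∀ n, tvNorm {A : Set Ω | MeasurableSet A} (F n) ≤ C)
    (lam : ba {A : Set Ω | MeasurableSet A}) (hlam : lam ∈ Prob {A : Set Ω | MeasurableSet A})
    (h : ℕ → SimpleFunc Ω ℝ) (hh : IndepLevels (lam : Set Ω → ℝ) h)
    (hFh : ∀ n, tvNorm {A : Set Ω | MeasurableSet A}
      ((F n : Set Ω → ℝ) - density {A : Set Ω | MeasurableSet A} lam (h n)) ≤ 1 / ((n : ℝ) + 1))
    (δ : ℝ) (hδ : 0 < δ) :
    ∃ (ξ : ba {A : Set Ω | MeasurableSet A}) (G : ℕ → ba {A : Set Ω | MeasurableSet A}),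
      0 ≤ ξ ∧
      (⨆ k : ℕ, limsup (fun n : ℕ => tvNorm {A : Set Ω | MeasurableSet A}
          (meet {A : Set Ω | MeasurableSet A} (F n) ((2 : ℝ) ^ k • lam :
            ba {A : Set Ω | MeasurableSet A}))) atTop) - δ
        ≤ tvNorm {A : Set Ω | MeasurableSet A} ξ ∧
      (∀ n, G n ∈ convexHull ℝ (F '' Set.Ici n)) ∧
      ∀ ε : ℝ, 0 < ε → ∃ A ∈ {A : Set Ω | MeasurableSet A},
        (ξ : Set Ω → ℝ) Aᶜ < ε ∧
        Tendsto (fun n => variation {A : Set Ω | MeasurableSet A}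
          (G n - ξ : ba {A : Set Ω | MeasurableSet A}) A) atTop (𝓝 0) := by
  obtain ⟨C, hC⟩ := hF_bdd
  have hl : IsFinAddProb (lam : Set Ω → ℝ) := .of_mem_Prob hlam
  have halg := isSetAlgebra_measurableSet (Ω := Ω)
  set f : ℕ → SimpleFunc Ω ℝ := fun n => (h n).map fun x => max x 0 with hf
  have hfi : IndepLevels (lam : Set Ω → ℝ) f := hh.map fun _ x => max x 0
  have hf0 : ∀ n x, 0 ≤ f n x := fun n x => by simp [hf]
  have happrox : ∀ n S, MeasurableSet S →
      |(F n : Set Ω → ℝ) S - hl.integral ((f n).restrict S)| ≤ 2 * (1 / ((n : ℝ) + 1)) := by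
    intro n S hS
    refine abs_sub_integral_posPart_le hl (fun A => hF n A) (h n) (fun T hT => ?_) hS
    refine le_trans ?_ (hFh n)
    rw [← density_eq_integral_restrict hl (h n) hT]
    exact abs_le_tvNorm halg (Submodule.sub_mem _ (F n).2 (density_mem_ba hl (h n))) hT
  have hfC : ∀ n, hl.integral (f n) ≤ C + 2 := by
    intro n
    have h1 := (abs_le.1 (happrox n Set.univ .univ)).1
    rw [SimpleFunc.restrict_univ] at h1
    have h2 := (le_abs_self _).trans (abs_le_tvNorm halg (F n).2
      (show Set.univ ∈ {A : Set Ω | MeasurableSet A} from MeasurableSet.univ))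
    have h3 : 1 / ((n : ℝ) + 1) ≤ 1 := by
      rw [div_le_one (by positivity)]
      linarith [(Nat.cast_nonneg n : (0 : ℝ) ≤ n)]
    linarith [hC n]
  have hmeet : ∀ n k, tvNorm {A : Set Ω | MeasurableSet A}
      (meet {A : Set Ω | MeasurableSet A} (F n) ((2 : ℝ) ^ k • lam :
        ba {A : Set Ω | MeasurableSet A})) ≤
      hl.integral ((f n).map fun x => min x (2 ^ k)) + 2 * (1 / ((n : ℝ) + 1)) := fun n k =>
    tvNorm_meet_le hl (F n).2 lam.2 (fun A => hF n A) (fun A => hlam.1 A) (f n)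
      (fun S hS => happrox n S hS) (by positivity)
  set c := ⨆ k : ℕ, limsup (fun n : ℕ => tvNorm {A : Set Ω | MeasurableSet A}
    (meet {A : Set Ω | MeasurableSet A} (F n) ((2 : ℝ) ^ k • lam :
      ba {A : Set Ω | MeasurableSet A}))) atTop with hc
  -- Half of `δ` pays for choosing `k₀`, the other half for the approximation error `2/(n+1)`.
  obtain ⟨k₀, hk₀⟩ := exists_lt_of_lt_ciSup (show c - δ / 2 < _ by rw [← hc]; linarith)
  have hfreq := frequently_lt_of_lt_limsup
    (isCoboundedUnder_le_of_le atTop fun n => variation_nonneg _ _) hk₀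
  have ht : Tendsto (fun n : ℕ => 2 * (1 / ((n : ℝ) + 1))) atTop (𝓝 0) := by
    simpa using (tendsto_one_div_add_atTop_nhds_zero_nat (𝕜 := ℝ)).const_mul 2
  have hfreq' : ∃ᶠ n in atTop, c - δ < hl.integral ((f n).map fun x => min x (2 ^ k₀)) := by
    refine (hfreq.and_eventually (ht.eventually (gt_mem_nhds (half_pos hδ)))).mono fun n hn => ?_
    have h1 := hn.1.trans_le (hmeet n k₀)
    linarith [hn.2]
  obtain ⟨D, φ, A, hφ, hD0, hDr, hAm, hAlim, hmain⟩ :=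
    hfi.exists_average_limit hl hf0 hfC k₀ hfreq'
  have hcard : ∀ n : ℕ, ((Finset.Icc n (2 * n)).card : ℝ) = (n : ℝ) + 1 := by
    intro n
    rw [Nat.card_Icc, show 2 * n + 1 - n = n + 1 by omega]
    push_cast
    ring
  refine ⟨D • lam, fun n => ∑ i ∈ Finset.Icc n (2 * n), ((n : ℝ) + 1)⁻¹ • F (φ i),
    fun B => mul_nonneg hD0 (hlam.1 B), ?_, fun n => ?_, fun ε hε => ?_⟩
  · have h1 := (le_abs_self _).trans (abs_le_tvNorm halg (D • lam).2
      (show Set.univ ∈ {A : Set Ω | MeasurableSet A} from MeasurableSet.univ))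
    have h2 : ((D • lam : ba {A : Set Ω | MeasurableSet A}) : Set Ω → ℝ) Set.univ = D := by
      simp [hl.univ]
    rw [h2] at h1
    exact hDr.trans h1
  · refine (convex_convexHull ℝ _).sum_mem (fun _ _ => by positivity) ?_ fun i hi => ?_
    · rw [Finset.sum_const, nsmul_eq_mul, hcard]
      exact mul_inv_cancel₀ (by positivity)
    · exact subset_convexHull ℝ _ ⟨φ i, (Finset.mem_Icc.1 hi).1.trans (hφ.id_le i), rfl⟩
  · have hDA : Tendsto (fun N => D * (lam : Set Ω → ℝ) (A N)ᶜ) atTop (𝓝 0) := by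
      simpa using hAlim.const_mul D
    obtain ⟨N, hN⟩ := (hDA.eventually (gt_mem_nhds hε)).exists
    refine ⟨A N, hAm N, by simpa using hN, ?_⟩
    rw [tendsto_order]
    refine ⟨fun b hb => Eventually.of_forall fun n => hb.trans_le (variation_nonneg _ _),
      fun b hb => ?_⟩
    filter_upwards [hmain N (b / 8) (by positivity),
      ht.eventually (gt_mem_nhds (show 0 < b / 8 by positivity))] with n hn hnt
    -- On each subset, `b/8` comes from replacing `F` by densities and `b/8` from the averages;
    -- passing to the variation doubles the sum to `b/2 < b`.
    refine (variation_le_of_abs_le halg (Submodule.coe_mem _ : _ ∈ ba _).2.1 (hAm N)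
      (c := b / 4) fun S hS hSA => ?_).trans_lt (by linarith)
    have h1 := hn S hS hSA
    have h2 : |((n : ℝ) + 1)⁻¹ * ∑ i ∈ Finset.Icc n (2 * n),
        ((F (φ i) : Set Ω → ℝ) S - hl.integral ((f (φ i)).restrict S))| ≤ b / 8 := by
      have hn0 : (0 : ℝ) < (n : ℝ) + 1 := by positivity
      rw [abs_mul, abs_of_pos (inv_pos.2 hn0), inv_mul_le_iff₀ hn0, ← hcard n, ← nsmul_eq_mul]
      refine (Finset.abs_sum_le_sum_abs _ _).trans (Finset.sum_le_card_nsmul _ _ _ fun i hi => ?_)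
      refine (happrox (φ i) S hS).trans (le_trans ?_ hnt.le)
      have : (n : ℝ) ≤ φ i := by
        exact_mod_cast (Finset.mem_Icc.1 hi).1.trans (hφ.id_le i)
      gcongr
    have h3 : ((∑ i ∈ Finset.Icc n (2 * n), ((n : ℝ) + 1)⁻¹ • F (φ i) - D • lam :
        ba {A : Set Ω | MeasurableSet A}) : Set Ω → ℝ) S =
        ((n : ℝ) + 1)⁻¹ * ∑ i ∈ Finset.Icc n (2 * n),
          ((F (φ i) : Set Ω → ℝ) S - hl.integral ((f (φ i)).restrict S)) +
        (((n : ℝ) + 1)⁻¹ * ∑ i ∈ Finset.Icc n (2 * n), hl.integral ((f (φ i)).restrict S)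
          - D * (lam : Set Ω → ℝ) S) := by
      rw [Finset.sum_sub_distrib, mul_sub, ← Finset.smul_sum]
      simp
    rw [h3]
    refine (abs_add_le _ _).trans ?_
    linarith

end MeasurableSets

end FinAdd

/-! ### The corollary. -/

theorem mainTheorem5 {Ω : Type*} [Nonempty Ω] (𝓐 : Set (Set Ω)) (h𝓐 : IsSetAlgebra 𝓐)
    (F : ℕ → FinAdd.ba (FinAdd.sigmaAlg 𝓐)) (hF_pos : ∀ n, 0 ≤ F n)
    (hF_bdd : ∃ C : ℝ, ∀ n, FinAdd.tvNorm (FinAdd.sigmaAlg 𝓐) (F n) ≤ C)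
    (lam : FinAdd.ba (FinAdd.sigmaAlg 𝓐)) (hlam : lam ∈ FinAdd.Prob (FinAdd.sigmaAlg 𝓐))
    (hind : FinAdd.IndependentRel 𝓐 F lam) (δ : ℝ) (hδ : 0 < δ) :
    ∃ (ξ : FinAdd.ba (FinAdd.sigmaAlg 𝓐)) (G : ℕ → FinAdd.ba (FinAdd.sigmaAlg 𝓐)),
      0 ≤ ξ ∧
      (⨆ k : ℕ, limsup (fun n : ℕ => FinAdd.tvNorm (FinAdd.sigmaAlg 𝓐)
          (FinAdd.meet (FinAdd.sigmaAlg 𝓐) (F n) ((2 : ℝ) ^ k • lam :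
            FinAdd.ba (FinAdd.sigmaAlg 𝓐)))) atTop) - δ
        ≤ FinAdd.tvNorm (FinAdd.sigmaAlg 𝓐) ξ ∧
      (∀ n, G n ∈ convexHull ℝ (F '' Set.Ici n)) ∧
      ∀ ε : ℝ, 0 < ε → ∃ A ∈ FinAdd.sigmaAlg 𝓐,
        (ξ : Set Ω → ℝ) Aᶜ < ε ∧
        Tendsto (fun n => FinAdd.variation (FinAdd.sigmaAlg 𝓐)
          (G n - ξ : FinAdd.ba (FinAdd.sigmaAlg 𝓐)) A) atTop (𝓝 0) := by
  obtain ⟨_, 𝓑, h𝓑, happ, hprod⟩ := hind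
  -- With this instance `sigmaAlg 𝓐` is by definition the family of measurable sets.
  let _ : MeasurableSpace Ω := MeasurableSpace.generateFrom 𝓐
  have hex : ∀ n : ℕ, ∃ h : FinAdd.Sim (𝓑 n), FinAdd.tvNorm (FinAdd.sigmaAlg 𝓐)
      ((F n : Set Ω → ℝ) - FinAdd.density (FinAdd.sigmaAlg 𝓐) lam h) < 1 / ((n : ℝ) + 1) := by
    intro n
    have : Nonempty (FinAdd.Sim (𝓑 n)) := by
      refine ⟨fun _ => 0, (Set.finite_singleton (0 : ℝ)).subset (by simp), fun c => ?_⟩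
      by_cases hc : (0 : ℝ) = c
      · simpa [Set.preimage_const, hc] using (h𝓑 n).1.univ_mem
      · simpa [Set.preimage_const, hc] using (h𝓑 n).1.empty_mem
    refine exists_lt_of_ciInf_lt ?_
    rw [happ n]
    positivity
  choose h hh using hex
  have hmem : ∀ n s, (h n : Ω → ℝ) ⁻¹' s ∈ 𝓑 n := fun n s =>
    FinAdd.preimage_mem_of_mem_Sim (h𝓑 n).1 (h n).2 s
  set g : ℕ → SimpleFunc Ω ℝ := fun n =>
    ⟨h n, fun c => MeasurableSpace.measurableSet_generateFrom ((h𝓑 n).2 (hmem n {c})),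
      (h n).2.1⟩
  refine FinAdd.exists_convexHull_limit F hF_pos hF_bdd lam hlam g (fun s => ?_)
    (fun n => (hh n).le) δ hδ
  -- The partition of `ℕ` into singletons is enough: level sets of `h i` lie in `𝓑 i`.
  refine hprod (fun i => {i}) (fun i => Finset.singleton_nonempty i)
    (fun i j hij => by simpa using hij) (fun n => ⟨n, Finset.mem_singleton_self n⟩)
    (fun i => g i ⁻¹' s i) fun i => ?_
  exact self_subset_generateSetAlgebra (Set.mem_biUnion (Finset.mem_singleton_self i) (hmem i (s i)))
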